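/- Let $G$ be a group. Call a family $\mathcal S$ of subgroups of $G$ \emph{admissible} if it is closed under conjugation by elements of $G$ and the intersection of any finite number of members of $\mathcal S$ contains a member of $\mathcal S$ (the empty intersection being $G$, so that $\mathcal S$ is nonempty). Say that a group $H$ \emph{already has complete cohomology} if $H^n(H,P)=0$ for every projective $\mathbb{Z}H$-module $P$ and every $n\ge 0$. \textbf{Theorem.} Let $\mathcal S$ be an admissible family of subgroups of $G$, each of which already has complete cohomology. Then $G$ already has complete cohomology, i.e. $H^n(G,P)=0$ for every projective $\mathbb{Z}G$-module $P$ and every $n\ge 0$. -/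

import Mathlib

universe u

/-- A family `S` of subgroups of `G` is admissible if it is closed under conjugation and the
intersection of any finite number of members of `S` contains a member of `S`. The intersection of
no members is `G` itself, so an admissible family is nonempty. -/
structure IsAdmissibleFamily {G : Type u} [Group G] (S : Set (Subgroup G)) : Prop where
  conj_mem : ∀ H ∈ S, ∀ g : G, H.map (MulAut.conj g).toMonoidHom ∈ S
  exists_le_sInf : ∀ F : Set (Subgroup G), F.Finite → F ⊆ S → ∃ K ∈ S, K ≤ sInf F

/-- The category of `ℤG`-modules, as integral representations of `G`. (The coefficient ring is
`ℤ` placed in the universe of `G`, as Mathlib's `groupCohomology` asks for.) -/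
abbrev IntegralRep (G : Type u) [Group G] : Type (u + 1) :=
  Rep.{u} (ULift.{u} ℤ) G

/-- `G` already has complete cohomology: the functors `Hⁿ(G, -)` vanish on projective
`ℤG`-modules, for all `n`. -/
def AlreadyHasCompleteCohomology (G : Type u) [Group G] : Prop :=
  ∀ P : IntegralRep G, CategoryTheory.Projective P →
    ∀ n : ℕ, CategoryTheory.Limits.IsZero (groupCohomology P n)

/-! A projective P stays projective over each H in S, so all cohomology of H in P vanishes. In
degree 0, no nonzero element of P is fixed by a member of S. Hence every map to P from an S-discrete
module is zero, and P is trivially `IsDiscretelyInjective`. Dimension shifting does the rest. Embed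
M in an I injective over G and over every subgroup. Vanishing of H¹(H, M) lifts H-invariants of I/M
to I; with discrete injectivity of M, maps from discrete modules to I/M then lift to I. So I/M is
again discretely injective, and in degree 1 the trivial module, itself discrete, shows that
G-invariants lift. -/

open CategoryTheory Limits

/-! ### Modules injective over all subgroups -/

namespace Rep

universe v

variable {k G H : Type v} [CommRing k] [Group G] [Group H]

/-- The representation of `G` on the functions `G → D` by right translation. -/
noncomputable abbrev functions (G : Type v) [Group G] (D : ModuleCat.{v} k) : Rep.{v} k G :=
  Rep.of (X := G → D)
    { toFun := fun g => LinearMap.funLeft k D (fun x => x * g)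
      map_one' := by ext; simp [LinearMap.funLeft_apply]
      map_mul' := fun a b => by ext; simp [LinearMap.funLeft_apply, mul_assoc] }

/-- Any linear map to an injective module extends along an injective linear map. -/
lemma exists_linear_extension (D : ModuleCat.{v} k) [Injective D] {A B : Type v} [AddCommGroup A]
    [AddCommGroup B] [Module k A] [Module k B] (i : A →ₗ[k] B) (hi : Function.Injective i)
    (f : A →ₗ[k] D) : ∃ F : B →ₗ[k] D, ∀ a, F (i a) = f a := by
  have : Mono (ModuleCat.ofHom i) := (ModuleCat.mono_iff_injective _).2 hi
  refine ⟨(Injective.factorThru (ModuleCat.ofHom f) (ModuleCat.ofHom i)).hom, fun a => ?_⟩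
  have := Injective.comp_factorThru (J := D) (ModuleCat.ofHom f) (ModuleCat.ofHom i)
  exact congr($(this).hom a)

lemma exists_coset_factorization (φ : H →* G) (hφ : Function.Injective φ) :
    ∃ (t : G → G) (s : G → H), (∀ g, t g * φ (s g) = g) ∧ (∀ g h, t (g * φ h) = t g) ∧
      ∀ g h, s (g * φ h) = s g * h := by
  let t : G → G := fun g => (QuotientGroup.mk g : G ⧸ φ.range).out
  have ht : ∀ g, ∃ s : H, t g * φ s = g := fun g => by
    have h1 : (QuotientGroup.mk (t g) : G ⧸ φ.range) = QuotientGroup.mk g := Quotient.out_eq' _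
    obtain ⟨s, hs⟩ := QuotientGroup.eq.1 h1
    exact ⟨s, by rw [hs]; group⟩
  choose s hs using ht
  have htm : ∀ g h, t (g * φ h) = t g := fun g h => by
    have : (QuotientGroup.mk (g * φ h) : G ⧸ φ.range) = QuotientGroup.mk g :=
      (QuotientGroup.eq.2 ⟨h, by group⟩ : (QuotientGroup.mk g : G ⧸ φ.range) = _).symm
    simp only [t, this]
  refine ⟨t, s, hs, htm, fun g h => hφ (mul_left_cancel (a := t g) ?_)⟩
  rw [map_mul, ← mul_assoc, hs g, ← htm g h, hs]

/-- An H-map into `G → D` is determined by its values at coset representatives, where they are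
arbitrary linear maps to D. Extend these and translate by `s g`. -/
instance injective_res_functions (φ : H →* G) [hφ : Fact (Function.Injective φ)]
    (D : ModuleCat.{v} k) [Injective D] : Injective (res φ (functions G D)) where
  factors {A B} f i _ := by
    obtain ⟨t, s, hts, htm, hsm⟩ := exists_coset_factorization φ hφ.out
    have hi := (mono_iff_injective i).1 inferInstance
    have ext : ∀ x : G, ∃ F : B →ₗ[k] D, ∀ a, F (i.hom a) = (f.hom a : G → D) x := fun x =>
      exists_linear_extension D i.hom.toLinearMap hi
        ((LinearMap.proj x : (G → D) →ₗ[k] D) ∘ₗ f.hom.toLinearMap)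
    choose F hF using ext
    refine ⟨ofHom ⟨LinearMap.pi fun g => F (t g) ∘ₗ B.ρ (s g), fun h => ?_⟩, ?_⟩
    · ext b g
      change F (t g) (B.ρ (s g) (B.ρ h b)) = F (t (g * φ h)) (B.ρ (s (g * φ h)) b)
      rw [htm, hsm, map_mul]
      rfl
    · ext a g
      change F (t g) (B.ρ (s g) (i.hom a)) = (f.hom a : G → D) g
      rw [← hom_comm_apply, hF, hom_comm_apply]
      exact congrArg (f.hom a : G → D) (hts g)

/-- The embedding of a representation into the functions on `G` given by an embedding of the
underlying module. -/
noncomputable def toFunctions (M : Rep.{v} k G) {D : ModuleCat.{v} k} (i : M →ₗ[k] D) :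
    M ⟶ functions G D :=
  ofHom ⟨LinearMap.pi fun g => i ∘ₗ M.ρ g, fun h => by
    ext m g
    change i (M.ρ g (M.ρ h m)) = i (M.ρ (g * h) m)
    rw [map_mul]
    rfl⟩

lemma toFunctions_injective (M : Rep.{v} k G) {D : ModuleCat.{v} k} (i : M →ₗ[k] D)
    (hi : Function.Injective i) : Function.Injective (toFunctions M i).hom := fun a b hab => by
  have : i (M.ρ 1 a) = i (M.ρ 1 b) := congrFun (show (_ : G → D) = _ from hab) 1
  simpa using hi this

/-- Every representation embeds in one whose restriction to each subgroup is injective. -/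
lemma exists_mono_forall_injective_res (M : Rep.{v} k G) :
    ∃ (I : Rep.{v} k G) (j : M ⟶ I), Mono j ∧ Injective I ∧
      ∀ K : Subgroup G, Injective (res K.subtype I) := by
  let D := Injective.under (ModuleCat.of k M)
  let i := Injective.ι (ModuleCat.of k M)
  have hi : Function.Injective i.hom := (ModuleCat.mono_iff_injective i).1 inferInstance
  have : Fact (Function.Injective (MonoidHom.id G)) := ⟨Function.injective_id⟩
  refine ⟨functions G D, toFunctions M i.hom, (mono_iff_injective _).2
    (toFunctions_injective M i.hom hi), injective_res_functions (MonoidHom.id G) D, fun K => ?_⟩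
  have : Fact (Function.Injective K.subtype) := ⟨K.subtype_injective⟩
  infer_instance

end Rep

/-! ### Low degrees and connecting maps -/

namespace groupCohomology

universe v

variable {k G : Type v} [CommRing k] [Group G]

lemma isZero_succ_of_injective (I : Rep.{v} k G) [Injective I] (n : ℕ) :
    IsZero (groupCohomology I (n + 1)) := by
  let P := Rep.barResolution k G
  refine IsZero.of_iso ?_ (groupCohomologyIso I (n + 1) P)
  rw [← HomologicalComplex.exactAt_iff_isZero_homology,
    HomologicalComplex.exactAt_iff' _ n (n + 1) (n + 2) (by simp) (by simp),
    ShortComplex.moduleCat_exact_iff]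
  intro f hf
  exact ⟨(P.exact_succ n).descToInjective f hf, (P.exact_succ n).comp_descToInjective f hf⟩

lemma isZero_zero_iff (A : Rep.{v} k G) :
    IsZero (groupCohomology A 0) ↔ ∀ a : A, (∀ g, A.ρ g a = a) → a = 0 := by
  rw [(H0Iso A).isZero_iff, ModuleCat.isZero_iff_subsingleton]
  refine ⟨fun h a ha => congrArg Subtype.val (Subsingleton.elim (⟨a, ha⟩ : A.ρ.invariants) 0),
    fun h => ⟨fun a b => Subtype.ext ?_⟩⟩
  rw [h a.1 a.2, h b.1 b.2]

lemma map_zero_surjective_iff {A B : Rep.{v} k G} (f : A ⟶ B) :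
    Function.Surjective (map (MonoidHom.id G) f 0) ↔
      ∀ b : B, (∀ g, B.ρ g b = b) → ∃ a : A, (∀ g, A.ρ g a = a) ∧ f.hom a = b := by
  have h := map_id_comp_H0Iso_hom f
  have hs : Function.Surjective (map (MonoidHom.id G) f 0) ↔
      Function.Surjective ((Rep.invariantsFunctor k G).map f) := by
    rw [← ModuleCat.epi_iff_surjective, ← ModuleCat.epi_iff_surjective]
    constructor <;> intro _
    · have : Epi ((H0Iso A).hom ≫ (Rep.invariantsFunctor k G).map f) := h ▸ inferInstance
      exact epi_of_epi (H0Iso A).hom _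
    · have : (map (MonoidHom.id G) f 0) =
        (H0Iso A).hom ≫ (Rep.invariantsFunctor k G).map f ≫ (H0Iso B).inv := by
        rw [← Category.assoc, Iso.eq_comp_inv, h]
      rw [this]
      infer_instance
  rw [hs]
  constructor
  · intro h b hb
    obtain ⟨a, ha⟩ := h ⟨b, hb⟩
    exact ⟨a.1, a.2, congrArg Subtype.val ha⟩
  · rintro h ⟨b, hb⟩
    obtain ⟨a, ha, hab⟩ := h b hb
    exact ⟨⟨a, ha⟩, Subtype.ext hab⟩

variable {X : ShortComplex (Rep.{v} k G)} (hX : X.ShortExact)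
include hX

lemma map_zero_surjective_of_isZero (h : IsZero (groupCohomology X.X₁ 1)) :
    Function.Surjective (map (MonoidHom.id G) X.g 0) := by
  rw [← ModuleCat.epi_iff_surjective]
  exact (mapShortComplex₃_exact hX (i := 0) (j := 1) rfl).epi_f (h.eq_of_tgt _ _)

lemma isZero_one_of_map_zero_surjective (h : IsZero (groupCohomology X.X₂ 1))
    (hs : Function.Surjective (map (MonoidHom.id G) X.g 0)) :
    IsZero (groupCohomology X.X₁ 1) := by
  have : Epi (map (MonoidHom.id G) X.g 0) := (ModuleCat.epi_iff_surjective _).2 hs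
  have h1 : Epi (δ hX 0 1 rfl) := epi_δ_of_isZero hX 0 h
  have h0 : δ hX 0 1 rfl = 0 := by
    rw [← cancel_epi (map (MonoidHom.id G) X.g 0), comp_zero]
    exact (mapShortComplex₃ hX (i := 0) (j := 1) rfl).zero
  exact IsZero.of_epi_eq_zero _ h0

end groupCohomology

/-! ### Discrete modules and lifting -/

namespace Rep

universe v

variable {k G : Type v} [CommRing k] [Group G]

/-- Every element of `A` is fixed by a member of `S`. -/
def IsDiscreteFor (S : Set (Subgroup G)) (A : Rep.{v} k G) : Prop :=
  ∀ a : A, ∃ H ∈ S, ∀ h ∈ H, A.ρ h a = a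

/-- Maps to `M` from subrepresentations of `S`-discrete representations extend. -/
def IsDiscretelyInjective (S : Set (Subgroup G)) (M : Rep.{v} k G) : Prop :=
  ∀ ⦃A B : Rep.{v} k G⦄ (i : A ⟶ B), Mono i → IsDiscreteFor S B → ∀ f : A ⟶ M,
    ∃ g : B ⟶ M, i ≫ g = f

lemma IsDiscreteFor.of_mono {S : Set (Subgroup G)} {A B : Rep.{v} k G} (i : A ⟶ B) [Mono i]
    (hB : IsDiscreteFor S B) : IsDiscreteFor S A := fun a => by
  obtain ⟨H, hH, h⟩ := hB (i.hom a)
  refine ⟨H, hH, fun g hg => (mono_iff_injective i).1 inferInstance ?_⟩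
  rw [hom_comm_apply, h g hg]

lemma isDiscretelyInjective_of_invariants_eq_zero {S : Set (Subgroup G)} (M : Rep.{v} k G)
    (h : ∀ H ∈ S, ∀ m : M, (∀ g ∈ H, M.ρ g m = m) → m = 0) : IsDiscretelyInjective S M := by
  refine fun A B i _ hB f => ⟨0, ?_⟩
  rw [comp_zero]
  ext a
  obtain ⟨H, hH, ha⟩ := hB.of_mono i a
  refine (h H hH _ fun g hg => ?_).symm
  change M.ρ g (f.hom a) = f.hom a
  rw [← hom_comm_apply, ha g hg]

/-- The elements fixed by some member of an admissible family. -/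
def discretePart {S : Set (Subgroup G)} (hS : IsAdmissibleFamily S) (M : Rep.{v} k G) :
    Submodule k M where
  carrier := {m | ∃ H ∈ S, ∀ h ∈ H, M.ρ h m = m}
  zero_mem' := by
    obtain ⟨K, hK, -⟩ := hS.exists_le_sInf ∅ Set.finite_empty (Set.empty_subset _)
    exact ⟨K, hK, fun _ _ => map_zero _⟩
  add_mem' := by
    rintro a b ⟨H, hH, ha⟩ ⟨L, hL, hb⟩
    obtain ⟨K, hK, hle⟩ := hS.exists_le_sInf {H, L} (Set.toFinite _) (by
      rintro _ (rfl | rfl) <;> assumption)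
    refine ⟨K, hK, fun h hh => ?_⟩
    have hm := hle hh
    rw [sInf_pair] at hm
    rw [map_add, ha h hm.1, hb h hm.2]
  smul_mem' := by
    rintro c a ⟨H, hH, ha⟩
    exact ⟨H, hH, fun h hh => by rw [map_smul, ha h hh]⟩

lemma discretePart_le_comap {S : Set (Subgroup G)} (hS : IsAdmissibleFamily S) (M : Rep.{v} k G)
    (g : G) : discretePart hS M ≤ (discretePart hS M).comap (M.ρ g) := by
  rintro m ⟨H, hH, hm⟩
  refine ⟨_, hS.conj_mem H hH g, ?_⟩
  rintro _ ⟨h, hh, rfl⟩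
  change M.ρ (g * h * g⁻¹) (M.ρ g m) = M.ρ g m
  rw [← Module.End.mul_apply, ← map_mul, inv_mul_cancel_right, map_mul, Module.End.mul_apply,
    hm h hh]

/-- The largest `S`-discrete subrepresentation. -/
noncomputable abbrev discrete {S : Set (Subgroup G)} (hS : IsAdmissibleFamily S)
    (M : Rep.{v} k G) : Rep.{v} k G :=
  subrepresentation M (discretePart hS M) (discretePart_le_comap hS M)

lemma isDiscreteFor_discrete {S : Set (Subgroup G)} (hS : IsAdmissibleFamily S)
    (M : Rep.{v} k G) : IsDiscreteFor S (discrete hS M) := by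
  rintro ⟨m, H, hH, hm⟩
  exact ⟨H, hH, fun h hh => Subtype.ext (hm h hh)⟩

lemma map_mem_discretePart {S : Set (Subgroup G)} (hS : IsAdmissibleFamily S)
    {M N : Rep.{v} k G} (f : M ⟶ N) {m : M} (hm : m ∈ discretePart hS M) :
    f.hom m ∈ discretePart hS N := by
  obtain ⟨H, hH, h⟩ := hm
  exact ⟨H, hH, fun g hg => by rw [← hom_comm_apply, h g hg]⟩

/-- The map induced on the largest `S`-discrete subrepresentations. -/
noncomputable def discreteMap {S : Set (Subgroup G)} (hS : IsAdmissibleFamily S)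
    {M N : Rep.{v} k G} (f : M ⟶ N) : discrete hS M ⟶ discrete hS N :=
  ofHom ⟨f.hom.toLinearMap.restrict fun _ => map_mem_discretePart hS f, fun g => by
    ext m
    exact hom_comm_apply f g m.1⟩

section ShortExact

variable {S : Set (Subgroup G)} (hS : IsAdmissibleFamily S) {X : ShortComplex (Rep.{v} k G)}
  (hX : X.ShortExact)
include hS hX

/-- If the kernel is discretely injective, the map to the quotient, restricted to the discrete
part, agrees with one that vanishes on the kernel. -/
lemma exists_discrete_hom_of_isDiscretelyInjective (h₁ : IsDiscretelyInjective S X.X₁) :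
    ∃ p : discrete hS X.X₂ ⟶ X.X₂, (∀ y, X.g.hom (p.hom y) = X.g.hom y.1) ∧
      ∀ y, X.g.hom y.1 = 0 → p.hom y = 0 := by
  have hf := (mono_iff_injective X.f).1 hX.mono_f
  have hmono : Mono (discreteMap hS X.f) := (mono_iff_injective _).2 fun a b hab =>
    Subtype.ext (hf (congrArg Subtype.val hab))
  obtain ⟨r, hr⟩ := h₁ (discreteMap hS X.f) hmono (isDiscreteFor_discrete hS X.X₂)
    (subtype X.X₁ (discretePart hS X.X₁) (discretePart_le_comap hS X.X₁))
  have hzero : ∀ m, X.g.hom (X.f.hom m) = 0 := fun m => by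
    have := congr($(X.zero).hom m)
    exact this
  -- Here `r` extends the inclusion of the discrete part of the kernel, so inclusion minus `r ≫ X.f`
  -- kills that part.
  refine ⟨subtype X.X₂ _ (discretePart_le_comap hS X.X₂) - r ≫ X.f, fun y => ?_, fun y hy => ?_⟩
  · change X.g.hom (y.1 - X.f.hom (r.hom y)) = _
    rw [map_sub, hzero, sub_zero]
  · obtain ⟨m, hm⟩ : ∃ m, X.f.hom m = y.1 :=
      (ShortComplex.moduleCat_exact_iff _).1
        (hX.exact.map (forget₂ (Rep k G) (ModuleCat k))) y.1 hy
    have hmd : m ∈ discretePart hS X.X₁ := by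
      obtain ⟨H, hH, h⟩ := y.2
      exact ⟨H, hH, fun g hg => hf (by rw [hom_comm_apply, hm, h g hg])⟩
    have hrm : r.hom y = m := by
      have := congr($(hr).hom ⟨m, hmd⟩)
      rw [← show (discreteMap hS X.f).hom ⟨m, hmd⟩ = y from Subtype.ext hm]
      exact this
    change y.1 - X.f.hom (r.hom y) = 0
    rw [hrm, hm, sub_self]

/-- If the kernel is discretely injective and invariants of members of `S` lift, then so do maps
from discrete representations. -/
lemma exists_lift_of_isDiscretelyInjective (h₁ : IsDiscretelyInjective S X.X₁)
    (hlift : ∀ H ∈ S, ∀ z : X.X₃, (∀ h ∈ H, X.X₃.ρ h z = z) →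
      ∃ y : X.X₂, (∀ h ∈ H, X.X₂.ρ h y = y) ∧ X.g.hom y = z)
    {A : Rep.{v} k G} (hA : IsDiscreteFor S A) (f : A ⟶ X.X₃) :
    ∃ f' : A ⟶ X.X₂, f' ≫ X.g = f := by
  obtain ⟨p, hp, hp0⟩ := exists_discrete_hom_of_isDiscretelyInjective hS hX h₁
  have hex : ∀ a : A, ∃ y : discrete hS X.X₂, X.g.hom y.1 = f.hom a := fun a => by
    obtain ⟨H, hH, ha⟩ := hA a
    obtain ⟨y, hy, hya⟩ := hlift H hH (f.hom a) fun h hh => by rw [← hom_comm_apply, ha h hh]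
    exact ⟨⟨y, H, hH, hy⟩, hya⟩
  choose y hy using hex
  -- After `p` the choice of discrete lift no longer matters, which makes the lift linear and
  -- equivariant.
  have huniq : ∀ a z, X.g.hom z.1 = f.hom a → p.hom z = p.hom (y a) := fun a z hz => by
    rw [← sub_eq_zero, ← map_sub]
    apply hp0
    change X.g.hom (z.1 - (y a).1) = 0
    rw [map_sub, hz, hy, sub_self]
  refine ⟨ofHom ⟨⟨⟨fun a => p.hom (y a), fun a b => ?_⟩, fun c a => ?_⟩, fun g => ?_⟩, ?_⟩
  · rw [← map_add]
    refine (huniq _ _ ?_).symm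
    change X.g.hom ((y a).1 + (y b).1) = _
    rw [map_add, hy, hy, map_add]
  · change p.hom (y (c • a)) = c • p.hom (y a)
    rw [← map_smul]
    refine (huniq _ _ ?_).symm
    change X.g.hom (c • (y a).1) = _
    rw [map_smul, hy, map_smul]
  · ext a
    change p.hom (y (A.ρ g a)) = X.X₂.ρ g (p.hom (y a))
    rw [← hom_comm_apply]
    refine (huniq _ _ ?_).symm
    change X.g.hom (X.X₂.ρ g (y a).1) = _
    rw [hom_comm_apply, hy, hom_comm_apply]
  · ext a
    exact (hp _).trans (hy a)

lemma isDiscretelyInjective_quotient [Injective X.X₂] (h₁ : IsDiscretelyInjective S X.X₁)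
    (hlift : ∀ H ∈ S, ∀ z : X.X₃, (∀ h ∈ H, X.X₃.ρ h z = z) →
      ∃ y : X.X₂, (∀ h ∈ H, X.X₂.ρ h y = y) ∧ X.g.hom y = z) :
    IsDiscretelyInjective S X.X₃ := fun A B i _ hB f => by
  obtain ⟨f', rfl⟩ := exists_lift_of_isDiscretelyInjective hS hX h₁ hlift (hB.of_mono i) f
  exact ⟨Injective.factorThru f' i ≫ X.g, by rw [Injective.comp_factorThru_assoc]⟩

/-- An invariant is a map from the trivial module, which is discrete because S is nonempty. -/
lemma exists_invariant_lift_of_isDiscretelyInjective (h₁ : IsDiscretelyInjective S X.X₁)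
    (hlift : ∀ H ∈ S, ∀ z : X.X₃, (∀ h ∈ H, X.X₃.ρ h z = z) →
      ∃ y : X.X₂, (∀ h ∈ H, X.X₂.ρ h y = y) ∧ X.g.hom y = z)
    (z : X.X₃) (hz : ∀ g, X.X₃.ρ g z = z) :
    ∃ y : X.X₂, (∀ g, X.X₂.ρ g y = y) ∧ X.g.hom y = z := by
  have hA : IsDiscreteFor S (trivial k G k) := fun a => by
    obtain ⟨K, hK, -⟩ := hS.exists_le_sInf ∅ Set.finite_empty (Set.empty_subset _)
    exact ⟨K, hK, fun _ _ => rfl⟩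
  obtain ⟨f', hf'⟩ := exists_lift_of_isDiscretelyInjective hS hX h₁ hlift hA
    (ofHom ⟨LinearMap.toSpanSingleton k X.X₃ z, fun g => by
      ext
      change (1 : k) • z = X.X₃.ρ g ((1 : k) • z)
      rw [one_smul, hz]⟩)
  refine ⟨f'.hom (1 : k), fun g => (hom_comm_apply f' g (1 : k)).symm, ?_⟩
  have : X.g.hom (f'.hom (1 : k)) = (1 : k) • z := congr($(hf').hom (1 : k))
  rw [this, one_smul]

end ShortExact

end Rep

/-! ### Dimension shifting -/

namespace groupCohomology

universe v

open Rep

variable {k G : Type v} [CommRing k] [Group G]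

theorem isZero_succ_of_isDiscretelyInjective {S : Set (Subgroup G)} (hS : IsAdmissibleFamily S)
    (n : ℕ) (M : Rep.{v} k G) (hM : IsDiscretelyInjective S M)
    (h : ∀ H ∈ S, ∀ q ≤ n, IsZero (groupCohomology (res H.subtype M) (q + 1))) :
    IsZero (groupCohomology M (n + 1)) := by
  induction n generalizing M with
  | zero =>
    obtain ⟨I, j, _, _, hI⟩ := exists_mono_forall_injective_res M
    let X : ShortComplex (Rep.{v} k G) := ShortComplex.mk j (cokernel.π j) (cokernel.condition j)
    have hX : X.ShortExact := { exact := ShortComplex.exact_cokernel j }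
    refine isZero_one_of_map_zero_surjective hX (isZero_succ_of_injective I 0)
      ((map_zero_surjective_iff _).2
        (exists_invariant_lift_of_isDiscretelyInjective hS hX hM fun H hH z hz => ?_))
    obtain ⟨y, hy, hyz⟩ := (map_zero_surjective_iff _).1 (map_zero_surjective_of_isZero
      ((shortExact_res H.subtype).2 hX) (h H hH 0 le_rfl)) z fun g => hz g g.2
    exact ⟨y, fun g hg => hy ⟨g, hg⟩, hyz⟩
  | succ n ih =>
    obtain ⟨I, j, _, _, hI⟩ := exists_mono_forall_injective_res M
    let X : ShortComplex (Rep.{v} k G) := ShortComplex.mk j (cokernel.π j) (cokernel.condition j)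
    have hX : X.ShortExact := { exact := ShortComplex.exact_cokernel j }
    have hδ := isIso_δ_of_isZero hX (n + 1) (isZero_succ_of_injective I n)
      (isZero_succ_of_injective I (n + 1))
    refine IsZero.of_iso (ih X.X₃ ?_ fun H hH q hq => ?_) (asIso (δ hX (n + 1) (n + 2) rfl)).symm
    · refine isDiscretelyInjective_quotient hS hX hM fun H hH z hz => ?_
      obtain ⟨y, hy, hyz⟩ := (map_zero_surjective_iff _).1 (map_zero_surjective_of_isZero
        ((shortExact_res H.subtype).2 hX) (h H hH 0 (Nat.zero_le _))) z fun g => hz g g.2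
      exact ⟨y, fun g hg => hy ⟨g, hg⟩, hyz⟩
    -- I is also acyclic over H, so the hypothesis on H shifts by one degree as well.
    · have hδ' := isIso_δ_of_isZero ((shortExact_res H.subtype).2 hX) (q + 1)
        (@isZero_succ_of_injective _ _ _ _ _ (hI H) q)
        (@isZero_succ_of_injective _ _ _ _ _ (hI H) (q + 1))
      exact IsZero.of_iso (h H hH (q + 1) (by lia))
        (@asIso _ _ _ _ _ hδ')

end groupCohomology

theorem mainTheorem5 {G : Type*} [Group G] (S : Set (Subgroup G))
    (hS : IsAdmissibleFamily S)
    (hcomplete : ∀ H ∈ S, AlreadyHasCompleteCohomology H) :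
    AlreadyHasCompleteCohomology G := by
  intro P hP n
  have hres : ∀ H ∈ S, ∀ q, IsZero (groupCohomology (Rep.res H.subtype P) q) := fun H hH q =>
    hcomplete H hH _ ((Rep.resFunctor H.subtype).projective_obj P) q
  have hinv : ∀ H ∈ S, ∀ m : P, (∀ g ∈ H, P.ρ g m = m) → m = 0 := fun H hH m hm =>
    (groupCohomology.isZero_zero_iff _).1 (hres H hH 0) m fun g => hm g g.2
  cases n with
  | zero =>
    obtain ⟨K, hK, -⟩ := hS.exists_le_sInf ∅ Set.finite_empty (Set.empty_subset _)
    exact (groupCohomology.isZero_zero_iff P).2 fun m hm => hinv K hK m fun g _ => hm g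
  | succ n =>
    exact groupCohomology.isZero_succ_of_isDiscretelyInjective hS n P
      (Rep.isDiscretelyInjective_of_invariants_eq_zero P hinv) fun H hH q _ => hres H hH (q + 1)
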